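/- Let $S^1=\mathbb R/\mathbb Z$ with its Haar measure $dx$ of total mass $1$, and equip $L^1(S^1)$ (complex-valued functions) with the cosine convolution $$(f\star_c g)(x)=\int_{S^1} f(y)\,\frac{g(x+y)+g(x-y)}{2}\,dy ,$$ which makes it a Banach algebra (neither commutativity nor a unit is assumed). Let $\Delta(L^1(S^1),\star_c)$ be its structure space, that is, the set of all nonzero continuous $\mathbb C$-linear maps $m:L^1(S^1)\to\mathbb C$ with $m(f\star_c g)=m(f)m(g)$ for all $f,g\in L^1(S^1)$, with the weak* topology, and for $f\in L^1(S^1)$ let $\widehat f\in C_0(\Delta(L^1(S^1),\star_c))$, $\widehat f(m):=m(f)$, be its Gelfand transform. Theorem. There is a homeomorphism $h$ from $\Delta(L^1(S^1),\star_c)$ onto $\mathbb N_0=\{0,1,2,\dots\}$ with the discrete topology such that $$m(f)=\int_0^1 f(x)\cos(2\pi h(m)x)\,dx\qquad\text{for all } m\in\Delta(L^1(S^1),\star_c),\ f\in L^1(S^1).$$ Consequently, when $\Delta(L^1(S^1),\star_c)$ is identified with $\mathbb N_0$ through $h$, the Gelfand transform is given by the cosine Fourier coefficients: $$\widehat f(h^{-1}(k))=\int_0^1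 f(x)\cos(2\pi kx)\,dx\qquad\text{for all } f\in L^1(S^1),\ k\in\mathbb N_0 .$$ -/

import Mathlib

open MeasureTheory Filter Topology
open scoped ZeroAtInfty

noncomputable section

namespace CosineConv

section Kernel

variable {G : Type*} [AddCommGroup G] [MeasurableSpace G] [MeasurableAdd₂ G]
  {μ : Measure G} [SFinite μ] [μ.IsAddLeftInvariant]

/-- The cosine convolution
`(f ⋆_c g)(x) = ∫ f(y) (g(x + y) + g(x - y)) / 2 dμ(y)`. -/
def cosConv {G : Type*} [AddCommGroup G] [MeasurableSpace G] (μ : Measure G)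
    (f g : G → ℂ) (x : G) : ℂ :=
  ∫ y, f y * ((g (x + y) + g (x - y)) / 2) ∂μ

theorem integrable_shear {α : Type*} [MeasurableSpace α] {ν : Measure α} [SFinite ν]
    {F : α → ℂ} {h : G → ℂ} {a : α → G} (hF : Integrable F ν) (hh : Integrable h μ)
    (ha : Measurable a) :
    Integrable (fun q : G × α => F q.2 * h (q.1 + a q.2)) (μ.prod ν) := by
  have h1 : Integrable (fun q : α × G => F q.1 * h q.2) (ν.prod μ) := hF.mul_prod hh
  have h2 : MeasurePreserving (fun q : α × G => (q.1, q.2 + a q.1)) (ν.prod μ) (ν.prod μ) := by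
    refine MeasurePreserving.skew_product (g := fun p z => z + a p)
      (MeasurePreserving.id ν) (by fun_prop) ?_
    exact Eventually.of_forall fun p => map_add_right_eq_self μ (a p)
  exact (h2.integrable_comp_of_integrable h1).swap

theorem integrable_shear_average {α : Type*} [MeasurableSpace α] {ν : Measure α} [SFinite ν]
    {F : α → ℂ} {h : G → ℂ} {a b : α → G} (hF : Integrable F ν) (hh : Integrable h μ)
    (ha : Measurable a) (hb : Measurable b) :
    Integrable (fun q : G × α => F q.2 * ((h (q.1 + a q.2) + h (q.1 + b q.2)) / 2))
      (μ.prod ν) := by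
  refine (((integrable_shear hF hh ha).add (integrable_shear hF hh hb)).div_const 2).congr
    (Eventually.of_forall fun q => ?_)
  simp only [Pi.add_apply]
  ring

variable [MeasurableNeg G]

theorem integrable_kernel {f g : G → ℂ} (hf : Integrable f μ) (hg : Integrable g μ) :
    Integrable (fun q : G × G => f q.2 * ((g (q.1 + q.2) + g (q.1 - q.2)) / 2)) (μ.prod μ) := by
  simpa only [sub_eq_add_neg, id] using
    integrable_shear_average (a := id) (b := fun y => -y) hf hg measurable_id measurable_neg

/-- The cosine convolution of integrable functions is integrable. -/
theorem integrable_cosConv {f g : G → ℂ} (hf : Integrable f μ) (hg : Integrable g μ) :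
    Integrable (cosConv μ f g) μ :=
  (integrable_kernel hf hg).integral_prod_left

/-- The integral defining the cosine convolution converges for almost every point. -/
theorem ae_integrable_cosConv {f g : G → ℂ} (hf : Integrable f μ) (hg : Integrable g μ) :
    ∀ᵐ x ∂μ, Integrable (fun y => f y * ((g (x + y) + g (x - y)) / 2)) μ :=
  (integrable_kernel hf hg).prod_right_ae

theorem integral_norm_cosConv_le {f g : G → ℂ} (hf : Integrable f μ) (hg : Integrable g μ) :
    ∫ x, ‖cosConv μ f g x‖ ∂μ ≤ (∫ x, ‖f x‖ ∂μ) * ∫ x, ‖g x‖ ∂μ := by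
  have hk := integrable_kernel hf hg
  calc ∫ x, ‖cosConv μ f g x‖ ∂μ
      ≤ ∫ x, ∫ y, ‖f y * ((g (x + y) + g (x - y)) / 2)‖ ∂μ ∂μ :=
        integral_mono (integrable_cosConv hf hg).norm hk.norm.integral_prod_left
          fun x => norm_integral_le_integral_norm _
    _ = ∫ y, ∫ x, ‖f y * ((g (x + y) + g (x - y)) / 2)‖ ∂μ ∂μ :=
        integral_integral_swap hk.norm
    _ ≤ ∫ y, ‖f y‖ * ∫ x, ‖g x‖ ∂μ ∂μ := by
        refine integral_mono hk.norm.integral_prod_right (hf.norm.mul_const _) fun y => ?_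
        have e1 : Integrable (fun x => ‖g (x + y)‖) μ := (hg.comp_add_right y).norm
        have e2 : Integrable (fun x => ‖g (x - y)‖) μ := (hg.comp_sub_right y).norm
        have e3 : ∫ x, ‖g (x + y)‖ ∂μ = ∫ x, ‖g x‖ ∂μ :=
          integral_add_right_eq_self (fun x => ‖g x‖) y
        have e4 : ∫ x, ‖g (x - y)‖ ∂μ = ∫ x, ‖g x‖ ∂μ :=
          integral_sub_right_eq_self (fun x => ‖g x‖) y
        calc ∫ x, ‖f y * ((g (x + y) + g (x - y)) / 2)‖ ∂μ
            ≤ ∫ x, ‖f y‖ * ((‖g (x + y)‖ + ‖g (x - y)‖) / 2) ∂μ := by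
              refine integral_mono_of_nonneg (Eventually.of_forall fun x => norm_nonneg _)
                (((e1.add e2).div_const 2).const_mul _) (Eventually.of_forall fun x => ?_)
              simp only [norm_mul, norm_div, Complex.norm_ofNat]
              gcongr
              exact norm_add_le _ _
          _ = ‖f y‖ * ∫ x, ‖g x‖ ∂μ := by
              rw [integral_const_mul, integral_div, integral_add e1 e2, e3, e4]
              ring
    _ = (∫ x, ‖f x‖ ∂μ) * ∫ x, ‖g x‖ ∂μ := integral_mul_const _ _

theorem cosConv_congr {f f' g g' : G → ℂ} (hf : f =ᵐ[μ] f') (hg : g =ᵐ[μ] g') :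
    cosConv μ f g =ᵐ[μ] cosConv μ f' g' := by
  have h1 : ∀ᵐ q ∂(μ.prod μ), g (q.1 + q.2) = g' (q.1 + q.2) := by
    have : MeasurePreserving (fun q : G × G => (q.1, q.2 + q.1)) (μ.prod μ) (μ.prod μ) :=
      MeasurePreserving.skew_product (g := fun p z => z + p)
        (MeasurePreserving.id μ) (by fun_prop)
        (Eventually.of_forall fun p => map_add_right_eq_self μ p)
    have h := (Measure.quasiMeasurePreserving_snd.comp this.quasiMeasurePreserving).ae_eq_comp hg
    filter_upwards [h] with q hq
    simpa [add_comm] using hq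
  have h2 : ∀ᵐ q ∂(μ.prod μ), g (q.1 - q.2) = g' (q.1 - q.2) := by
    have : MeasurePreserving (fun q : G × G => (q.1, q.2 + -q.1)) (μ.prod μ) (μ.prod μ) :=
      MeasurePreserving.skew_product (g := fun p z => z + -p)
        (MeasurePreserving.id μ) (by fun_prop)
        (Eventually.of_forall fun p => map_add_right_eq_self μ (-p))
    have h := ((Measure.quasiMeasurePreserving_snd.comp this.quasiMeasurePreserving).comp
      Measure.measurePreserving_swap.quasiMeasurePreserving).ae_eq_comp hg
    filter_upwards [h] with q hq
    simpa [sub_eq_add_neg] using hq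
  filter_upwards [Measure.ae_ae_of_ae_prod h1, Measure.ae_ae_of_ae_prod h2] with x hx1 hx2
  refine integral_congr_ae ?_
  filter_upwards [hf, hx1, hx2] with y e1 e2 e3
  rw [e1, e2, e3]

theorem cosConv_assoc {f g h : G → ℂ} (hf : Integrable f μ) (hg : Integrable g μ)
    (hh : Integrable h μ) :
    cosConv μ (cosConv μ f g) h =ᵐ[μ] cosConv μ f (cosConv μ g h) := by
  -- points `p = (x, y)` of `G × G`
  have hfg : Integrable (fun p : G × G => f p.2 * g p.1) (μ.prod μ) :=
    (hf.mul_prod hg).swap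
  have hP : Integrable (fun p : G × G => f p.2 * g (p.1 + p.2)) (μ.prod μ) := by
    simpa using integrable_shear (a := id) hf hg measurable_id
  have hM : Integrable (fun p : G × G => f p.2 * g (p.1 - p.2)) (μ.prod μ) := by
    simpa [sub_eq_add_neg] using integrable_shear (a := fun y => -y) hf hg measurable_neg
  have hT1 := (integrable_shear_average (a := fun p : G × G => p.1) (b := fun p => -p.1)
    hP hh (by fun_prop) (by fun_prop)).prod_right_ae
  have hT2 := (integrable_shear_average (a := fun p : G × G => p.1) (b := fun p => -p.1)
    hM hh (by fun_prop) (by fun_prop)).prod_right_ae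
  have hU1 := (integrable_shear_average (a := fun p : G × G => p.2 + p.1)
    (b := fun p => p.2 + -p.1) hfg hh (by fun_prop) (by fun_prop)).prod_right_ae
  have hU2 := (integrable_shear_average (a := fun p : G × G => -p.2 + p.1)
    (b := fun p => -p.2 + -p.1) hfg hh (by fun_prop) (by fun_prop)).prod_right_ae
  filter_upwards [hT1, hT2, hU1, hU2] with z t1 t2 u1 u2
  have shear : ∀ (s : G → G), Measurable s → ∀ F : G × G → ℂ,
      Integrable (fun p : G × G => F (p.1 + s p.2, p.2)) (μ.prod μ) →
      Integrable F (μ.prod μ) →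
      ∫ p, F (p.1 + s p.2, p.2) ∂(μ.prod μ) = ∫ p, F p ∂(μ.prod μ) := by
    intro s hs F i1 i2
    rw [integral_prod_symm _ i1, integral_prod_symm _ i2]
    refine integral_congr_ae (Eventually.of_forall fun y => ?_)
    exact integral_add_right_eq_self (fun x => F (x, y)) (s y)
  -- the four shifted kernels
  let H : G → G → ℂ := fun w x => (h (w + x) + h (w - x)) / 2
  have hmp : ∀ (s : G → G), Measurable s →
      MeasurePreserving (fun p : G × G => (p.1 + s p.2, p.2)) (μ.prod μ) (μ.prod μ) := by
    intro s hs
    have : MeasurePreserving (fun q : G × G => (q.1, q.2 + s q.1)) (μ.prod μ) (μ.prod μ) :=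
      MeasurePreserving.skew_product (g := fun p z => z + s p)
        (MeasurePreserving.id μ) (by fun_prop)
        (Eventually.of_forall fun p => map_add_right_eq_self μ (s p))
    exact (Measure.measurePreserving_swap.comp this).comp Measure.measurePreserving_swap
  have t1' : Integrable (fun p : G × G => f p.2 * g (p.1 + p.2) * H z p.1) (μ.prod μ) := by
    simpa [H, sub_eq_add_neg] using t1
  have t2' : Integrable (fun p : G × G => f p.2 * g (p.1 - p.2) * H z p.1) (μ.prod μ) := by
    simpa [H, sub_eq_add_neg] using t2
  have u1' : Integrable (fun p : G × G => f p.2 * g p.1 * H (z + p.2) p.1) (μ.prod μ) := by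
    simpa [H, sub_eq_add_neg, add_assoc] using u1
  have u2' : Integrable (fun p : G × G => f p.2 * g p.1 * H (z - p.2) p.1) (μ.prod μ) := by
    simpa [H, sub_eq_add_neg, add_assoc] using u2
  have s1' : Integrable (fun p : G × G => f p.2 * g p.1 * H z (p.1 - p.2)) (μ.prod μ) := by
    have := (hmp (fun y => -y) measurable_neg).integrable_comp_of_integrable t1'
    refine this.congr (Eventually.of_forall fun p => ?_)
    simp [sub_eq_add_neg]
  have s2' : Integrable (fun p : G × G => f p.2 * g p.1 * H z (p.1 + p.2)) (μ.prod μ) := by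
    have := (hmp (fun y => y) measurable_id).integrable_comp_of_integrable t2'
    refine this.congr (Eventually.of_forall fun p => ?_)
    simp
  have E1 : ∫ p, f p.2 * g (p.1 + p.2) * H z p.1 ∂(μ.prod μ)
      = ∫ p, f p.2 * g p.1 * H z (p.1 - p.2) ∂(μ.prod μ) := by
    have := shear (fun y => y) measurable_id
      (fun p : G × G => f p.2 * g p.1 * H z (p.1 - p.2)) (by simpa using t1') s1'
    simpa using this
  have E2 : ∫ p, f p.2 * g (p.1 - p.2) * H z p.1 ∂(μ.prod μ)
      = ∫ p, f p.2 * g p.1 * H z (p.1 + p.2) ∂(μ.prod μ) := by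
    have := shear (fun y => -y) measurable_neg
      (fun p : G × G => f p.2 * g p.1 * H z (p.1 + p.2))
      (by simpa [sub_eq_add_neg] using t2') s2'
    simpa [sub_eq_add_neg] using this
  have L : cosConv μ (cosConv μ f g) h z
      = (∫ p, f p.2 * g (p.1 + p.2) * H z p.1 ∂(μ.prod μ)
        + ∫ p, f p.2 * g (p.1 - p.2) * H z p.1 ∂(μ.prod μ)) / 2 := by
    rw [← integral_add t1' t2', ← integral_div]
    refine Eq.trans ?_ (integral_prod _ ((t1'.add t2').div_const 2)).symm
    refine integral_congr_ae (Eventually.of_forall fun x => ?_)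
    simp only [cosConv, Pi.add_apply]
    rw [← integral_mul_const]
    refine integral_congr_ae (Eventually.of_forall fun y => ?_)
    simp only [H]
    ring
  have R : cosConv μ f (cosConv μ g h) z
      = (∫ p, f p.2 * g p.1 * H (z + p.2) p.1 ∂(μ.prod μ)
        + ∫ p, f p.2 * g p.1 * H (z - p.2) p.1 ∂(μ.prod μ)) / 2 := by
    rw [integral_prod_symm _ u1', integral_prod_symm _ u2',
      ← integral_add u1'.integral_prod_right u2'.integral_prod_right, ← integral_div]
    refine integral_congr_ae (Eventually.of_forall fun y => ?_)
    simp only [cosConv, mul_assoc, integral_const_mul, H]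
    ring
  rw [L, R, E1, E2, ← integral_add s1' s2', ← integral_add u1' u2']
  congr 1
  refine integral_congr_ae (Eventually.of_forall fun p => ?_)
  have a1 : z + (p.1 - p.2) = z - p.2 + p.1 := by abel
  have a2 : z - (p.1 - p.2) = z + p.2 - p.1 := by abel
  have a3 : z + (p.1 + p.2) = z + p.2 + p.1 := by abel
  have a4 : z - (p.1 + p.2) = z - p.2 - p.1 := by abel
  simp only [H, a1, a2, a3, a4]
  ring

theorem cosConv_add_left {f f' g : G → ℂ} (hf : Integrable f μ) (hf' : Integrable f' μ)
    (hg : Integrable g μ) :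
    cosConv μ (f + f') g =ᵐ[μ] cosConv μ f g + cosConv μ f' g := by
  filter_upwards [ae_integrable_cosConv hf hg, ae_integrable_cosConv hf' hg] with x h1 h2
  simp only [cosConv, Pi.add_apply, add_mul]
  exact integral_add h1 h2

theorem cosConv_add_right {f g g' : G → ℂ} (hf : Integrable f μ) (hg : Integrable g μ)
    (hg' : Integrable g' μ) :
    cosConv μ f (g + g') =ᵐ[μ] cosConv μ f g + cosConv μ f g' := by
  filter_upwards [ae_integrable_cosConv hf hg, ae_integrable_cosConv hf hg'] with x h1 h2
  simp only [cosConv, Pi.add_apply]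
  rw [← integral_add h1 h2]
  refine integral_congr_ae (Eventually.of_forall fun y => ?_)
  simp only
  ring

theorem cosConv_smul_left {G : Type*} [AddCommGroup G] [MeasurableSpace G]
    (μ : Measure G) (c : ℂ) (f g : G → ℂ) :
    cosConv μ (c • f) g = c • cosConv μ f g := by
  funext x
  simp only [cosConv, Pi.smul_apply, smul_eq_mul, mul_assoc, integral_const_mul]

theorem cosConv_smul_right {G : Type*} [AddCommGroup G] [MeasurableSpace G]
    (μ : Measure G) (c : ℂ) (f g : G → ℂ) :
    cosConv μ f (c • g) = c • cosConv μ f g := by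
  funext x
  simp only [cosConv, Pi.smul_apply, smul_eq_mul]
  rw [← integral_const_mul]
  refine integral_congr_ae (Eventually.of_forall fun y => ?_)
  simp only
  ring

end Kernel

section Algebra

/-- The Banach space `L¹(G, μ)` of complex-valued functions; below it is given the cosine
convolution as multiplication. -/
def CosineL1 {G : Type*} [MeasurableSpace G] (μ : Measure G) : Type _ := Lp ℂ 1 μ

variable {G : Type*} [MeasurableSpace G] {μ : Measure G}

instance : NormedAddCommGroup (CosineL1 μ) := inferInstanceAs (NormedAddCommGroup (Lp ℂ 1 μ))
instance : NormedSpace ℂ (CosineL1 μ) := inferInstanceAs (NormedSpace ℂ (Lp ℂ 1 μ))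
instance : CompleteSpace (CosineL1 μ) := inferInstanceAs (CompleteSpace (Lp ℂ 1 μ))

/-- The underlying class in `L¹`. -/
def CosineL1.toL1 (f : CosineL1 μ) : Lp ℂ 1 μ := f

instance : CoeFun (CosineL1 μ) (fun _ => G → ℂ) := ⟨fun f => (f.toL1 : G → ℂ)⟩

theorem CosineL1.integrable (f : CosineL1 μ) : Integrable f μ := L1.integrable_coeFn f.toL1

theorem CosineL1.ext_ae {f g : CosineL1 μ} (h : (f : G → ℂ) =ᵐ[μ] g) : f = g :=
  Lp.ext (f := f.toL1) (g := g.toL1) h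

theorem CosineL1.coeFn_add (f g : CosineL1 μ) : ((f + g : CosineL1 μ) : G → ℂ) =ᵐ[μ] f + g :=
  Lp.coeFn_add f.toL1 g.toL1

theorem CosineL1.coeFn_smul (c : ℂ) (f : CosineL1 μ) :
    ((c • f : CosineL1 μ) : G → ℂ) =ᵐ[μ] c • (f : G → ℂ) :=
  Lp.coeFn_smul c f.toL1

theorem CosineL1.norm_eq (f : CosineL1 μ) : ‖f‖ = ∫ x, ‖f x‖ ∂μ :=
  L1.norm_eq_integral_norm f.toL1

variable [AddCommGroup G] [MeasurableAdd₂ G] [MeasurableNeg G] [SFinite μ]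
  [μ.IsAddLeftInvariant]

/-- The multiplication of `(L¹(G), ⋆_c)`. -/
instance : Mul (CosineL1 μ) :=
  ⟨fun f g => (integrable_cosConv f.integrable g.integrable).toL1 (cosConv μ f g)⟩

theorem CosineL1.coeFn_mul (f g : CosineL1 μ) :
    ((f * g : CosineL1 μ) : G → ℂ) =ᵐ[μ] cosConv μ f g :=
  Integrable.coeFn_toL1 (integrable_cosConv f.integrable g.integrable)

theorem CosineL1.add_mul' (f f' g : CosineL1 μ) : (f + f') * g = f * g + f' * g := by
  refine ext_ae ?_
  refine (coeFn_mul _ _).trans (((cosConv_congr (coeFn_add f f') .rfl).trans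
    (cosConv_add_left f.integrable f'.integrable g.integrable)).trans ?_)
  exact (((coeFn_add _ _).trans ((coeFn_mul f g).add (coeFn_mul f' g)))).symm

theorem CosineL1.mul_add' (f g g' : CosineL1 μ) : f * (g + g') = f * g + f * g' := by
  refine ext_ae ?_
  refine (coeFn_mul _ _).trans (((cosConv_congr .rfl (coeFn_add g g')).trans
    (cosConv_add_right f.integrable g.integrable g'.integrable)).trans ?_)
  exact (((coeFn_add _ _).trans ((coeFn_mul f g).add (coeFn_mul f g')))).symm

theorem CosineL1.smul_mul' (c : ℂ) (f g : CosineL1 μ) : (c • f) * g = c • (f * g) := by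
  refine ext_ae ?_
  refine (coeFn_mul _ _).trans ((cosConv_congr (coeFn_smul c f) .rfl).trans ?_)
  rw [cosConv_smul_left]
  exact ((coeFn_smul _ _).trans ((coeFn_mul f g).const_smul c)).symm

theorem CosineL1.mul_smul' (c : ℂ) (f g : CosineL1 μ) : f * (c • g) = c • (f * g) := by
  refine ext_ae ?_
  refine (coeFn_mul _ _).trans ((cosConv_congr .rfl (coeFn_smul c g)).trans ?_)
  rw [cosConv_smul_right]
  exact ((coeFn_smul _ _).trans ((coeFn_mul f g).const_smul c)).symm

theorem CosineL1.mul_assoc' (f g h : CosineL1 μ) : f * g * h = f * (g * h) := by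
  refine ext_ae ?_
  refine (coeFn_mul _ _).trans ((cosConv_congr (coeFn_mul f g) .rfl).trans
    ((cosConv_assoc f.integrable g.integrable h.integrable).trans ?_))
  exact ((coeFn_mul _ _).trans (cosConv_congr .rfl (coeFn_mul g h))).symm

theorem CosineL1.norm_mul_le' (f g : CosineL1 μ) : ‖f * g‖ ≤ ‖f‖ * ‖g‖ := by
  rw [norm_eq, norm_eq, norm_eq]
  refine le_trans (le_of_eq ?_) (integral_norm_cosConv_le f.integrable g.integrable)
  exact integral_congr_ae ((coeFn_mul f g).fun_comp _)

/-- `(L¹(G), ⋆_c)` is a (not necessarily commutative, not necessarily unital) Banach algebra. -/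
instance : NonUnitalNormedRing (CosineL1 μ) :=
  { (inferInstance : NormedAddCommGroup (CosineL1 μ)), (inferInstance : Mul (CosineL1 μ)) with
    left_distrib := CosineL1.mul_add'
    right_distrib := CosineL1.add_mul'
    zero_mul := fun f => by
      have h := CosineL1.smul_mul' 0 (0 : CosineL1 μ) f
      rwa [zero_smul, zero_smul] at h
    mul_zero := fun f => by
      have h := CosineL1.mul_smul' 0 f (0 : CosineL1 μ)
      rwa [zero_smul, zero_smul] at h
    mul_assoc := CosineL1.mul_assoc'
    norm_mul_le := CosineL1.norm_mul_le' }

instance : IsScalarTower ℂ (CosineL1 μ) (CosineL1 μ) := ⟨CosineL1.smul_mul'⟩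

instance : SMulCommClass ℂ (CosineL1 μ) (CosineL1 μ) :=
  ⟨fun c f g => (CosineL1.mul_smul' c f g).symm⟩

/-- The Banach algebra `(L¹(S¹), ⋆_c)`, where `S¹ = ℝ/ℤ` carries its Haar measure of total
mass one. -/
abbrev CircleAlgebra : Type := CosineL1 (volume : Measure UnitAddCircle)

end Algebra

section Gelfand

variable {A : Type*} [NonUnitalNormedRing A] [NormedSpace ℂ A]

/-- The structure space `Δ(A)` of a complex Banach algebra `A`: all nonzero continuous
multiplicative linear functionals `A → ℂ`, with the weak-* topology. -/
abbrev StructureSpace (A : Type*) [NonUnitalNormedRing A] [NormedSpace ℂ A] : Type _ :=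
  WeakDual.characterSpace ℂ A

theorem norm_character_le [IsScalarTower ℂ A A] [SMulCommClass ℂ A A]
    (m : StructureSpace A) (f : A) : ‖m f‖ ≤ ‖f‖ := by
  by_contra! hlt
  have hm0 : 0 < ‖m f‖ := (norm_nonneg f).trans_lt hlt
  let u : ℕ → A := fun n => (fun g => f * g)^[n] f
  have hu : ∀ n, m (u n) = m f ^ (n + 1) ∧ ‖u n‖ ≤ ‖f‖ ^ (n + 1) := by
    intro n
    induction n with
    | zero => simp [u]
    | succ n ih =>
      have e : u (n + 1) = f * u n := Function.iterate_succ_apply' _ _ _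
      rw [e, map_mul, ih.1]
      refine ⟨by ring, (norm_mul_le _ _).trans ?_⟩
      calc ‖f‖ * ‖u n‖ ≤ ‖f‖ * ‖f‖ ^ (n + 1) := by gcongr; exact ih.2
        _ = ‖f‖ ^ (n + 1 + 1) := by ring
  have hb : ∀ n, 1 ≤ ‖WeakDual.CharacterSpace.toCLM m‖ * (‖f‖ / ‖m f‖) ^ (n + 1) := by
    intro n
    have h1 := (WeakDual.CharacterSpace.toCLM m).le_opNorm (u n)
    rw [WeakDual.CharacterSpace.coe_toCLM, (hu n).1, norm_pow] at h1
    have h2 : ‖m f‖ ^ (n + 1) ≤ ‖WeakDual.CharacterSpace.toCLM m‖ * ‖f‖ ^ (n + 1) :=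
      h1.trans (by gcongr; exact (hu n).2)
    rw [div_pow, ← mul_div_assoc, le_div_iff₀ (by positivity), one_mul]
    exact h2
  have hlim : Tendsto (fun n : ℕ => ‖WeakDual.CharacterSpace.toCLM m‖ * (‖f‖ / ‖m f‖) ^ (n + 1))
      atTop (𝓝 (‖WeakDual.CharacterSpace.toCLM m‖ * 0)) :=
    ((tendsto_pow_atTop_nhds_zero_of_lt_one (by positivity)
      ((div_lt_one hm0).2 hlt)).comp (tendsto_add_atTop_nat 1)).const_mul _
  have := ge_of_tendsto' hlim hb
  simp at this
  linarith

theorem tendsto_eval_cocompact [IsScalarTower ℂ A A] [SMulCommClass ℂ A A] (f : A) :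
    Tendsto (fun m : StructureSpace A => m f) (cocompact (StructureSpace A)) (𝓝 0) := by
  rw [Metric.tendsto_nhds]
  intro ε hε
  rw [Filter.Eventually, mem_cocompact]
  refine ⟨{m | ε ≤ ‖m f‖}, ?_, fun m hm => by simpa using hm⟩
  rw [Topology.IsInducing.subtypeVal.isCompact_iff]
  have hK : IsCompact (WeakDual.toStrongDual ⁻¹' Metric.closedBall (0 : StrongDual ℂ A) 1) :=
    WeakDual.isCompact_closedBall 0 1
  have hC : IsClosed ((WeakDual.characterSpace ℂ A ∪ {0}) ∩ {φ : WeakDual ℂ A | ε ≤ ‖φ f‖}) :=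
    (WeakDual.CharacterSpace.union_zero_isClosed ℂ A).inter
      (isClosed_le continuous_const (WeakDual.eval_continuous f).norm)
  refine hK.of_isClosed_subset (s := _) ?_ ?_
  · convert hC using 1
    ext φ
    constructor
    · rintro ⟨m, hm, rfl⟩
      exact ⟨Or.inl m.2, hm⟩
    · rintro ⟨h | h, h'⟩
      · exact ⟨⟨φ, h⟩, h', rfl⟩
      · rw [Set.mem_singleton_iff] at h
        subst h
        have : ε ≤ ‖(0 : ℂ)‖ := h'
        rw [norm_zero] at this
        linarith
  · rintro _ ⟨m, -, rfl⟩
    simp only [Set.mem_preimage, mem_closedBall_zero_iff]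
    exact ContinuousLinearMap.opNorm_le_bound _ zero_le_one fun g => by
      rw [one_mul]; exact norm_character_le m g

/-- The Gelfand transform `Γ : A → C₀(Δ(A))`, `Γ(f)(m) = m(f)`. -/
def gelfandTransform [IsScalarTower ℂ A A] [SMulCommClass ℂ A A] (f : A) :
    C₀(StructureSpace A, ℂ) where
  toFun m := m f
  continuous_toFun := (WeakDual.eval_continuous f).comp continuous_subtype_val
  zero_at_infty' := tendsto_eval_cocompact f

end Gelfand

end CosineConv

end

open MeasureTheory Filter Topology
open scoped ZeroAtInfty

noncomputable section

namespace CosineConv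

/-! Write e_n(x) = exp(2πinx). Averaging e_n(x + y) and e_n(x - y) gives e_n(x) cos(2πny), so every
f acts on e_n from the left as a scalar: f ⋆_c e_n = c_n(f) e_n, with c_n(f) the cosine coefficient
(`mul_expL1`). Almost everything follows from this one relation.

By associativity, c_n is multiplicative. Conversely, if m is a character with m(e_n) ≠ 0, applying m
to the relation and cancelling m(e_n) gives m = c_n. Such an n exists because the exponentials span
a dense subspace of L¹ (`eq_zero_of_forall_expL1`). Since c_n = c_{-n}, the characters are indexed
by |n|.

Orthogonality of the exponentials shows that, for k, n ≥ 0, c_k(e_n) ≠ 0 exactly when k = n. Hence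
distinct k give distinct characters, and the weak* open condition m(e_k) ≠ 0 isolates c_k, which
makes the topology discrete. -/

theorem integral_fourier (n : ℤ) :
    ∫ x : UnitAddCircle, fourier n x = if n = 0 then 1 else 0 := by
  split_ifs with hn
  · subst hn
    simp [measureReal_def]
  -- Translation by 1/(2n) changes the sign of the exponential but preserves Haar measure, so the
  -- integral equals its own negative.
  · exact integral_eq_zero_of_add_right_eq_neg
      (fourier_add_half_inv_index hn one_pos)

/-- The cosine `x ↦ cos (2πkx)` on the circle, as a complex-valued continuous function. -/
def cosine (k : ℤ) : C(UnitAddCircle, ℂ) := (1 / 2 : ℂ) • (fourier k + fourier (-k))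

theorem cosine_apply (k : ℤ) (x : UnitAddCircle) :
    cosine k x = (fourier k x + fourier (-k) x) / 2 := by
  simp only [cosine, ContinuousMap.coe_smul, ContinuousMap.coe_add, Pi.smul_apply, Pi.add_apply,
    smul_eq_mul]
  ring

theorem cosine_neg (k : ℤ) : cosine (-k) = cosine k := by
  ext x
  rw [cosine_apply, cosine_apply, neg_neg, add_comm]

theorem cosine_natAbs (k : ℤ) : cosine (k.natAbs : ℤ) = cosine k := by
  rcases Int.natAbs_eq k with h | h
  · rw [← h]
  · rw [h, cosine_neg, Int.natAbs_neg, Int.natAbs_natCast]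

theorem cosine_coe (k : ℕ) (x : ℝ) :
    cosine k (x : UnitAddCircle) = (Real.cos (2 * Real.pi * (k : ℝ) * x) : ℂ) := by
  rw [cosine_apply, fourier_coe_apply, fourier_coe_apply, Complex.ofReal_cos, Complex.cos]
  push_cast
  congr 3 <;> ring_nf

/-- The cosine Fourier coefficient `∫ f(x) cos (2πkx) dx`. -/
def cosCoeff (k : ℤ) (f : CircleAlgebra) : ℂ := ∫ y, f y * cosine k y

/-- Exponentials are indexed by ℤ and characters by ℕ; evenness of the cosine passes from one to the
other. -/
theorem cosCoeff_natAbs (k : ℤ) (f : CircleAlgebra) : cosCoeff k.natAbs f = cosCoeff k f := by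
  rw [cosCoeff, cosCoeff, cosine_natAbs]

theorem cosCoeff_eq_intervalIntegral (k : ℕ) (f : CircleAlgebra) :
    cosCoeff k f = ∫ x in (0 : ℝ)..1,
      f (x : UnitAddCircle) * (Real.cos (2 * Real.pi * (k : ℝ) * x) : ℂ) := by
  have h := UnitAddCircle.intervalIntegral_preimage 0 fun y => f y * cosine k y
  rw [zero_add] at h
  rw [cosCoeff, ← h]
  simp only [cosine_coe]

/-! ### Exponentials in L¹ and their density -/

/-- The class of a continuous function on the circle. -/
def ofContinuous : C(UnitAddCircle, ℂ) →L[ℂ] CircleAlgebra :=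
  ContinuousMap.toLp (E := ℂ) 1 volume ℂ

theorem coeFn_ofContinuous (u : C(UnitAddCircle, ℂ)) :
    (ofContinuous u : UnitAddCircle → ℂ) =ᵐ[volume] u :=
  ContinuousMap.coeFn_toLp (𝕜 := ℂ) volume u

theorem denseRange_ofContinuous : DenseRange ofContinuous :=
  ContinuousMap.toLp_denseRange ℂ (volume : Measure UnitAddCircle) ℂ ENNReal.one_ne_top

/-- The exponential `x ↦ exp (2πinx)` as an element of `L¹`. -/
def expL1 (n : ℤ) : CircleAlgebra := ofContinuous (fourier n)

theorem coeFn_expL1 (n : ℤ) : (expL1 n : UnitAddCircle → ℂ) =ᵐ[volume] fourier n :=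
  coeFn_ofContinuous _

/-- Makes c ↦ c • e_n injective, so that identities between coefficients can be checked after
multiplying by e_n. -/
theorem expL1_ne_zero (n : ℤ) : expL1 n ≠ 0 := by
  intro h
  have h1 : ‖expL1 n‖ = 1 := by
    rw [CosineL1.norm_eq]
    have h2 : ∀ᵐ x : UnitAddCircle, ‖expL1 n x‖ = 1 := by
      filter_upwards [coeFn_expL1 n] with x hx
      rw [hx]
      exact Circle.norm_coe _
    rw [integral_congr_ae h2]
    simp [measureReal_def]
  simp [h] at h1

/-- A continuous functional on `L¹` that vanishes on the exponentials is zero. -/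
theorem eq_zero_of_forall_expL1 (φ : CircleAlgebra →L[ℂ] ℂ) (h : ∀ n, φ (expL1 n) = 0) :
    φ = 0 := by
  -- Trigonometric polynomials are uniformly dense in the continuous functions, which are in turn
  -- dense in L¹.
  have h1 : φ.comp ofContinuous = 0 := by
    refine ContinuousLinearMap.ext_on (s := Set.range (@fourier 1)) ?_ ?_
    · exact (Submodule.dense_iff_topologicalClosure_eq_top).2 span_fourier_closure_eq_top
    · rintro _ ⟨n, rfl⟩
      exact h n
  ext f
  exact congrFun (denseRange_ofContinuous.equalizer (h := fun _ => (0 : ℂ)) φ.continuous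
    continuous_const (funext fun u => DFunLike.congr_fun h1 u)) f

/-- The factor e_n(x) comes out of both e_n(x + y) and e_n(x - y), leaving the average of e_n(y) and
e_{-n}(y), which is the cosine. The product is not assumed commutative, so the exponential must
stand on the right. -/
theorem mul_expL1 (f : CircleAlgebra) (n : ℤ) : f * expL1 n = cosCoeff n f • expL1 n := by
  refine CosineL1.ext_ae ?_
  refine (CosineL1.coeFn_mul _ _).trans ((cosConv_congr .rfl (coeFn_expL1 n)).trans ?_)
  refine EventuallyEq.trans ?_
    ((CosineL1.coeFn_smul _ _).trans ((coeFn_expL1 n).const_smul _)).symm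
  refine Eventually.of_forall fun x => ?_
  simp only [cosConv, Pi.smul_apply, smul_eq_mul, cosCoeff]
  rw [← integral_mul_const]
  refine integral_congr_ae (Eventually.of_forall fun y => ?_)
  have e1 : fourier n (x + y) = fourier n x * fourier n y := by
    simp [fourier_apply, smul_add, AddCircle.toCircle_add]
  have e2 : fourier n (x - y) = fourier n x * fourier (-n) y := by
    simp [fourier_apply, sub_eq_add_neg, AddCircle.toCircle_add]
  simp only [e1, e2, cosine_apply]
  ring

/-! ### Cosine coefficients as characters -/

/-- The cosine Fourier coefficient as a continuous linear functional. -/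
def cosCoeffCLM (k : ℤ) : CircleAlgebra →L[ℂ] ℂ :=
  LinearMap.mkContinuous
    { toFun := cosCoeff k
      -- Linearity is inherited from that of f ↦ f * e_k, with no integral to manipulate.
      map_add' := fun f g => smul_left_injective ℂ (expL1_ne_zero k) <| by
        simp only [add_smul, ← mul_expL1, add_mul]
      map_smul' := fun c f => smul_left_injective ℂ (expL1_ne_zero k) <| by
        simp only [RingHom.id_apply, smul_assoc, ← mul_expL1, smul_mul_assoc] }
    1 fun f => by
      -- The bound 1 is submultiplicativity of the norm applied to f * e_k, divided by ‖e_k‖.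
      refine le_of_mul_le_mul_right ?_ (norm_pos_iff.2 (expL1_ne_zero k))
      rw [LinearMap.coe_mk, AddHom.coe_mk, ← norm_smul, ← mul_expL1, one_mul]
      exact norm_mul_le _ _

/-- Both sides are the eigenvalue of f * g on e_k, computed directly or through (f * g) * e_k = f *
(g * e_k). -/
theorem cosCoeff_mul (k : ℤ) (f g : CircleAlgebra) :
    cosCoeff k (f * g) = cosCoeff k f * cosCoeff k g :=
  smul_left_injective ℂ (expL1_ne_zero k) <| by
    simp only
    rw [← mul_expL1, mul_assoc, mul_expL1, mul_smul_comm, mul_expL1, smul_smul, mul_comm]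

/-- Orthogonality of the exponentials. For n = k the value is 1/2, except that both indicators fire
when n = k = 0 and give 1. -/
theorem cosCoeff_expL1 (k n : ℤ) :
    cosCoeff k (expL1 n) = ((if n + k = 0 then 1 else 0) + (if n = k then 1 else 0)) / 2 := by
  have h : cosCoeff k (expL1 n) =
      ∫ y : UnitAddCircle, (fourier (n + k) y + fourier (n - k) y) / 2 := by
    refine integral_congr_ae ?_
    filter_upwards [coeFn_expL1 n] with y hy
    rw [hy, cosine_apply, sub_eq_add_neg, fourier_add, fourier_add]
    ring
  have hi : ∀ j : ℤ, Integrable (fun y : UnitAddCircle => fourier j y) := fun j =>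
    (fourier j).continuous.integrable_of_hasCompactSupport (HasCompactSupport.of_compactSpace _)
  rw [h, integral_div, integral_add (hi _) (hi _), integral_fourier, integral_fourier]
  simp only [sub_eq_zero]

theorem cosCoeff_natCast_expL1_ne_zero_iff (k n : ℕ) :
    cosCoeff k (expL1 n) ≠ 0 ↔ k = n := by
  rw [cosCoeff_expL1]
  constructor
  · intro h
    by_contra hkn
    apply h
    -- Both indices are natural numbers, so n + k = 0 would also force k = n.
    rw [if_neg (by omega), if_neg (by omega)]
    norm_num
  · rintro rfl
    rw [if_pos rfl]
    split_ifs <;> norm_num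

/-- The character of `(L¹(S¹), ⋆_c)` given by the `k`-th cosine Fourier coefficient. -/
def cosCharacter (k : ℕ) : StructureSpace CircleAlgebra :=
  ⟨StrongDual.toWeakDual (cosCoeffCLM k), by
    intro h
    exact (cosCoeff_natCast_expL1_ne_zero_iff k k).2 rfl
      (DFunLike.congr_fun h (expL1 k)), cosCoeff_mul k⟩

theorem cosCharacter_apply (k : ℕ) (f : CircleAlgebra) : cosCharacter k f = cosCoeff k f := rfl

theorem cosCharacter_injective : Function.Injective cosCharacter := fun k n h => by
  rw [← cosCoeff_natCast_expL1_ne_zero_iff, ← cosCharacter_apply, h, cosCharacter_apply]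
  exact (cosCoeff_natCast_expL1_ne_zero_iff n n).2 rfl

theorem cosCharacter_surjective : Function.Surjective cosCharacter := fun m => by
  -- A character is nonzero by definition, so it cannot vanish on every exponential.
  obtain ⟨n, hn⟩ : ∃ n, m (expL1 n) ≠ 0 := by
    by_contra! h
    exact m.2.1 (eq_zero_of_forall_expL1 (WeakDual.CharacterSpace.toCLM m) h)
  refine ⟨n.natAbs, WeakDual.CharacterSpace.ext fun f => ?_⟩
  rw [cosCharacter_apply, cosCoeff_natAbs]
  -- This reads m(f) m(e_n) = c_n(f) m(e_n), and m(e_n) cancels.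
  have h := congrArg m (mul_expL1 f n)
  rw [map_mul, map_smul, smul_eq_mul] at h
  exact (mul_right_cancel₀ hn h).symm

/-! ### Discreteness of the structure space -/

/-- Evaluation at e_k is weak* continuous, and c_k is the only character that does not vanish there.
-/
theorem isOpen_singleton_cosCharacter (k : ℕ) : IsOpen {cosCharacter k} := by
  have h : {cosCharacter k} = {m : StructureSpace CircleAlgebra | m (expL1 k) ≠ 0} := by
    ext m
    obtain ⟨n, rfl⟩ := cosCharacter_surjective m
    rw [Set.mem_singleton_iff, cosCharacter_injective.eq_iff, Set.mem_ofPred_eq,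
      cosCharacter_apply, cosCoeff_natCast_expL1_ne_zero_iff]
  rw [h]
  exact isOpen_ne.preimage ((WeakDual.eval_continuous (expL1 k)).comp continuous_subtype_val)

instance : DiscreteTopology (StructureSpace CircleAlgebra) :=
  discreteTopology_iff_isOpen_singleton.2 fun m => by
    obtain ⟨k, rfl⟩ := cosCharacter_surjective m
    exact isOpen_singleton_cosCharacter k

/-- The structure space of `(L¹(S¹), ⋆_c)` is the discrete space `ℕ`. -/
def structureSpaceHomeomorph : StructureSpace CircleAlgebra ≃ₜ ℕ :=
  (Equiv.ofBijective cosCharacter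
    ⟨cosCharacter_injective, cosCharacter_surjective⟩).symm.toHomeomorphOfDiscrete

theorem structureSpaceHomeomorph_symm_apply (k : ℕ) (f : CircleAlgebra) :
    structureSpaceHomeomorph.symm k f = cosCoeff k f := rfl

end CosineConv

end

theorem mainTheorem5 :
    ∃ h : CosineConv.StructureSpace CosineConv.CircleAlgebra ≃ₜ ℕ,
      (∀ (m : CosineConv.StructureSpace CosineConv.CircleAlgebra) (f : CosineConv.CircleAlgebra),
        m f = ∫ x in (0 : ℝ)..1,
          f (x : UnitAddCircle) * (Real.cos (2 * Real.pi * (h m : ℝ) * x) : ℂ)) ∧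
      ∀ (f : CosineConv.CircleAlgebra) (k : ℕ),
        CosineConv.gelfandTransform f (h.symm k) =
          ∫ x in (0 : ℝ)..1,
            f (x : UnitAddCircle) * (Real.cos (2 * Real.pi * (k : ℝ) * x) : ℂ) := by
  have key : ∀ (f : CosineConv.CircleAlgebra) (k : ℕ),
      CosineConv.structureSpaceHomeomorph.symm k f = ∫ x in (0 : ℝ)..1,
        f (x : UnitAddCircle) * (Real.cos (2 * Real.pi * (k : ℝ) * x) : ℂ) := fun f k => by
    rw [CosineConv.structureSpaceHomeomorph_symm_apply, CosineConv.cosCoeff_eq_intervalIntegral]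
  -- The Gelfand transform at a character is by definition evaluation, so `key` is already the
  -- second claim; the first is `key` at k = h(m).
  refine ⟨CosineConv.structureSpaceHomeomorph, fun m f => ?_, key⟩
  rw [← key, Homeomorph.symm_apply_apply]
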